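/- Let $k>0$ and let $\omega_M=\frac{\sqrt{-1}}{2}\,dz\wedge d\bar z$ be the standard flat Kähler form on $\mathbf C$. Let $L=\mathbf C\times\mathbf C\to\mathbf C$ be the trivial holomorphic line bundle with base coordinate $z$ and fibre coordinate $w$, equipped with a smooth Hermitian metric $h:\mathbf C\to(0,\infty)$ (the squared norm of $w$ in the fibre over $z$ is $h(z)|w|^2$) whose curvature form is constant and negative: $-\sqrt{-1}\,\partial\bar\partial\log h=-2\pi k\,\omega_M$. Then $(z,w)$ are global holomorphic coordinates identifying the total space of $L$ biholomorphically with $\mathbf C^2$, and the total space admits a smooth Kähler metric $g$ such that: (a) the Kähler form $\omega$ of $g$ arises from the Calabi ansatz: off the zero section, $\omega=p^*\omega_M+2\sqrt{-1}\,\partial\bar\partial f(t)$ for a smooth function $f:\mathbf R\to\mathbf R$, where $p:L\to\mathbf C$ is the projection and $t=\frac12\log\bigl(h(z)|w|^2\bigr)$; (b) $g$ is complete; (c) the scalar curvature of $g$ vanishes identically; (d) $g$ is not Ricci-flat; (e) the fibre metric is asymptotically cylindrical: for each $z\in\mathbf C$, the restriction of $g$ to the fibre over $z$ has the form $a_z(w)\,|dw|^2$,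 and in the coordinate $\zeta=\log w$ the metric $a_z(e^\zeta)|e^\zeta|^2\,|d\zeta|^2$ converges, as $\mathrm{Re}\,\zeta\to\infty$, uniformly in $\mathrm{Im}\,\zeta$ and together with all its derivatives in $\zeta$, to $c\,|d\zeta|^2$ for some constant $c>0$. -/

import Mathlib

open scoped Manifold ContDiff Topology ENNReal ComplexConjugate ComplexOrder
open Filter

noncomputable section

namespace MomentumKahler

/-! ## Wirtinger derivatives -/

section Wirtinger

variable {E : Type*} [NormedAddCommGroup E] [NormedSpace ℝ E] [NormedSpace ℂ E]

/-- The derivative of type `(1,0)` of a complex-valued function in the complex direction `v`,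
`∂_v f = (D f (v) - i D f (i v)) / 2`. For `v` the `j`-th standard basis vector of `ℂⁿ` this is
`∂f/∂z^j`. -/
def del (v : E) (f : E → ℂ) (p : E) : ℂ :=
  (fderiv ℝ f p v - Complex.I * fderiv ℝ f p (Complex.I • v)) / 2

/-- The derivative of type `(0,1)` of a complex-valued function in the complex direction `v`,
`∂̄_v f = (D f (v) + i D f (i v)) / 2`. For `v` the `j`-th standard basis vector of `ℂⁿ` this is
`∂f/∂z̄^j`. -/
def delbar (v : E) (f : E → ℂ) (p : E) : ℂ :=
  (fderiv ℝ f p v + Complex.I * fderiv ℝ f p (Complex.I • v)) / 2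

end Wirtinger

/-- The coefficient `∂²u/∂z^i∂z̄^j` of the complex Hessian of a real function on `ℂⁿ`, so that
`∂∂̄u = ∑ (complexHessian u)_{i j̄} dz^i ∧ dz̄^j`. -/
def complexHessian {n : ℕ} (u : (Fin n → ℂ) → ℝ) (p : Fin n → ℂ) : Matrix (Fin n) (Fin n) ℂ :=
  Matrix.of fun i j =>
    del (Pi.single i 1) (fun q => delbar (Pi.single j 1) (fun x => (u x : ℂ)) q) p

/-! ## Kähler metrics on `ℂⁿ` -/

/-- A (smooth) Kähler metric on `ℂⁿ`, given by its components `g_{i j̄}` in the standard holomorphic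
coordinates. The Kähler form is `ω = (i/2) ∑ g_{i j̄} dz^i ∧ dz̄^j`, and the underlying Riemannian
metric is `Re ∑ g_{i j̄} dz^i ⊗ dz̄^j`. The field `closed` says `∂ω = 0`; as `ω` is real, this is
equivalent to `dω = 0`. -/
structure KahlerMetric (n : ℕ) where
  /-- The matrix of components `g_{i j̄}` at a point. -/
  coeff : (Fin n → ℂ) → Matrix (Fin n) (Fin n) ℂ
  smooth : ∀ i j, ContDiff ℝ ∞ fun p => coeff p i j
  posDef : ∀ p, (coeff p).PosDef
  closed : ∀ i j l p, del (Pi.single l 1) (fun q => coeff q i j) p =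
    del (Pi.single i 1) (fun q => coeff q l j) p

namespace KahlerMetric

variable {n : ℕ} (g : KahlerMetric n)

/-- The length of the tangent vector `v` at `p`: the square root of `∑ g_{i j̄} v^i v̄^j`. -/
def tangentNorm (p v : Fin n → ℂ) : ℝ :=
  √(∑ i, ∑ j, g.coeff p i j * v i * conj (v j)).re

/-- The Riemannian distance: the infimum of the `g`-lengths of `C¹` paths from `p` to `q`. -/
def edist (p q : Fin n → ℂ) : ℝ≥0∞ :=
  letI : ∀ x : Fin n → ℂ, ENorm (TangentSpace 𝓘(ℝ, Fin n → ℂ) x) :=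
    fun x => ⟨fun v => ENNReal.ofReal (g.tangentNorm x v)⟩
  Manifold.riemannianEDist 𝓘(ℝ, Fin n → ℂ) p q

/-- Completeness: every Cauchy sequence for the Riemannian distance converges. -/
def IsComplete : Prop :=
  ∀ u : ℕ → Fin n → ℂ,
    (∀ ε : ℝ≥0∞, 0 < ε → ∃ N, ∀ a ≥ N, ∀ b ≥ N, g.edist (u a) (u b) < ε) →
      ∃ p, Tendsto (fun a => g.edist (u a) p) atTop (𝓝 0)

/-- The Ricci curvature `R_{i j̄} = -∂_i ∂_j̄ log det (g_{k l̄})`; the Ricci form is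
`ρ = i ∑ R_{i j̄} dz^i ∧ dz̄^j = -i ∂∂̄ log det (g_{k l̄})`. -/
def ricci (p : Fin n → ℂ) : Matrix (Fin n) (Fin n) ℂ :=
  -complexHessian (fun q => Real.log (g.coeff q).det.re) p

/-- The metric is Ricci-flat: the Ricci form vanishes identically. -/
def IsRicciFlat : Prop := ∀ p, g.ricci p = 0

/-- The scalar curvature, the trace `2 ∑ g^{i j̄} R_{i j̄}` of the Ricci form `ρ` with respect to the
Kähler form `ω` (half of the trace of the Riemannian Ricci tensor). -/
def scalarCurvature (p : Fin n → ℂ) : ℂ := 2 * ((g.coeff p)⁻¹ * g.ricci p).trace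

/-- The metric is scalar-flat: the scalar curvature vanishes identically. -/
def IsScalarFlat : Prop := ∀ p, g.scalarCurvature p = 0

end KahlerMetric

/-! ## The trivial line bundle over `ℂ`

A point of the total space is written `![w, z]`, where `z` is the base point and `w` the fibre
coordinate. An Hermitian metric on the bundle is a smooth positive function `h` on `ℂ`: the squared
norm of `![w, z]` is `h z * |w|²`. -/

/-- The function `κ` such that the curvature form `γ = -i ∂∂̄ log h` of `h` equals `κ ω_M`, where
`ω_M = (i/2) dz ∧ dz̄`; explicitly, `κ = -2 ∂²(log h)/∂z∂z̄`. -/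
def curvatureCoeff (h : ℂ → ℝ) (z : ℂ) : ℂ :=
  -2 * del 1 (fun y => delbar 1 (fun x => (Real.log (h x) : ℂ)) y) z

/-- The logarithm `t` of the norm function of the Hermitian metric `h`, off the zero section. -/
def logNorm (h : ℂ → ℝ) (p : Fin 2 → ℂ) : ℝ :=
  Real.log (h (p 1) * ‖p 0‖ ^ 2) / 2

/-- The metric arises from the Calabi ansatz: `ω = p^*ω_M + 2 i ∂∂̄ f(t)` off the zero section, for a
smooth function `f` of one real variable, where `ω_M = (i/2) dz ∧ dz̄` on the base `ℂ`. In
components, `g_{i j̄} = δ_{i1} δ_{j1} + 4 ∂_i ∂_j̄ f(t)`. -/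
def KahlerMetric.IsBundleAdapted (g : KahlerMetric 2) (h : ℂ → ℝ) : Prop :=
  ∃ f : ℝ → ℝ, ContDiff ℝ ∞ f ∧ ∀ p : Fin 2 → ℂ, p 0 ≠ 0 →
    g.coeff p = Matrix.single 1 1 1 + (4 : ℂ) • complexHessian (fun q => f (logNorm h q)) p

/-- The restriction of the metric to the fibre over `z` is `a(w) |dw|²`, where `a = fibreFactor z`. -/
def KahlerMetric.fibreFactor (g : KahlerMetric 2) (z w : ℂ) : ℝ := (g.coeff ![w, z] 0 0).re

/-- The conformal metric `a(w) |dw|²` on `ℂ` is asymptotically cylindrical: in the logarithmic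
coordinate `ζ = log w`, in which it reads `a(e^ζ) |e^ζ|² |dζ|²`, it converges as `Re ζ → ∞`, with
all derivatives and uniformly in `Im ζ`, to a flat cylinder metric `c |dζ|²`, `c > 0`. -/
def IsAsymptoticallyCylindrical (a : ℂ → ℝ) : Prop :=
  ∃ c : ℝ, 0 < c ∧ ∀ m : ℕ, Tendsto
    (fun ζ : ℂ => ‖iteratedFDeriv ℝ m
      (fun ξ : ℂ => a (Complex.exp ξ) * ‖Complex.exp ξ‖ ^ 2 - c) ζ‖)
    (comap Complex.re atTop) (𝓝 0)

end MomentumKahler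

end

noncomputable section

namespace MomentumKahler

/-! ### Wirtinger derivatives of real functions: chain rules and symmetry. -/

section OfReal

variable {E : Type*} [NormedAddCommGroup E] [NormedSpace ℝ E] {p v : E} {u : E → ℝ} {F : ℝ → ℝ} {F' : ℝ}

/-! Put `K = 2πk`, `s = h|w|²` and `τ = f'(t)`. In the frame `dw + w ∂log h dz`, `dz` the Calabi
ansatz is diagonal: its base coefficient is `Q = 1 + Kτ`, and its fibre coefficient times `|w|²` is
the momentum profile `φ = dτ/dt`. Over a flat base the scalar curvature is a multiple of `(Qφ)''/Q`,
primes being `d/dτ`. Smooth closing at the zero section requires `φ(0) = 0`, `φ'(0) = 2`, so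
scalar-flatness leads to `Qφ = 2τ`. Integrating `dτ/dt = 2τ/(1 + Kτ)` gives `τ exp(Kτ) = s` up to
scaling `s`; `moment` inverts this relation, and `f(t) = potential K (e^{2t})`.

The inverse function theorem makes `τ` smooth in `s` even at `s = 0`, so the metric extends over the
zero section (`contDiffAt_moment_and_eventually`). One Hessian formula,
`complexHessian_comp_normSq`, yields both the metric (`calabiCoeff_eq`) and, since its determinant
is `2h exp(-Kτ)`, the Ricci form (`ricci_calabiMetric`). The two Ricci eigenvalues are nonzero and
opposite, so the metric is scalar-flat but not Ricci-flat.

Completeness: `(z, τ)` is a proper map with bounded derivative. Cylindrical end: `|w|²` times the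
fibre coefficient is `2τ/(1 + Kτ)`, which tends to `2/K`, and its distance to `2/K` is a multiple of
a solution of a polynomial ODE, which controls all derivatives. -/

lemma fderiv_ofReal_comp (hu : DifferentiableAt ℝ u p) :
    fderiv ℝ (fun x => (u x : ℂ)) p v = (fderiv ℝ u p v : ℝ) := by
  have := (Complex.ofRealCLM.hasFDerivAt (x := u p)).comp p hu.hasFDerivAt
  refine (congrArg (fun L : E →L[ℝ] ℂ => L v) this.fderiv).trans ?_
  simp

lemma contDiff_ofReal_comp {n : ℕ∞ω} (hu : ContDiff ℝ n u) :
    ContDiff ℝ n fun x => (u x : ℂ) :=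
  Complex.ofRealCLM.contDiff.comp hu

lemma fderiv_ofReal_chain (hu : DifferentiableAt ℝ u p) (hF : HasDerivAt F F' (u p)) :
    fderiv ℝ (fun x => (F (u x) : ℂ)) p v = F' * fderiv ℝ (fun x => (u x : ℂ)) p v := by
  have h := hF.comp_hasFDerivAt p hu.hasFDerivAt
  have h2 := fderiv_ofReal_comp (v := v) h.differentiableAt
  simp only [Function.comp_apply] at h2
  rw [h2, fderiv_ofReal_comp hu, h.fderiv]
  simp

end OfReal

section WirtingerCalculus

variable {E : Type*} [NormedAddCommGroup E] [NormedSpace ℝ E] [NormedSpace ℂ E]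
  {f g : E → ℂ} {p v : E}

lemma del_congr (hfg : f =ᶠ[𝓝 p] g) : del v f p = del v g p := by
  simp only [del, hfg.fderiv_eq]

lemma delbar_congr (hfg : f =ᶠ[𝓝 p] g) : delbar v f p = delbar v g p := by
  simp only [delbar, hfg.fderiv_eq]

lemma del_add_fun (hf : DifferentiableAt ℝ f p) (hg : DifferentiableAt ℝ g p) :
    del v (fun x => f x + g x) p = del v f p + del v g p := by
  simp only [del, fderiv_fun_add hf hg, add_apply]
  ring

lemma delbar_add_fun (hf : DifferentiableAt ℝ f p) (hg : DifferentiableAt ℝ g p) :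
    delbar v (fun x => f x + g x) p = delbar v f p + delbar v g p := by
  simp only [delbar, fderiv_fun_add hf hg, add_apply]
  ring

lemma del_mul_fun (hf : DifferentiableAt ℝ f p) (hg : DifferentiableAt ℝ g p) :
    del v (fun x => f x * g x) p = f p * del v g p + g p * del v f p := by
  simp only [del, fderiv_fun_mul hf hg, add_apply, smul_apply,
    smul_eq_mul]
  ring

lemma delbar_mul_fun (hf : DifferentiableAt ℝ f p) (hg : DifferentiableAt ℝ g p) :
    delbar v (fun x => f x * g x) p = f p * delbar v g p + g p * delbar v f p := by
  simp only [delbar, fderiv_fun_mul hf hg, add_apply, smul_apply,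
    smul_eq_mul]
  ring

@[simp] lemma del_const (c : ℂ) : del v (fun _ => c) p = 0 := by simp [del]

@[simp] lemma delbar_const (c : ℂ) : delbar v (fun _ => c) p = 0 := by simp [delbar]

lemma fderiv_eq_del_add_delbar : fderiv ℝ f p v = del v f p + delbar v f p := by
  simp only [del, delbar]; ring

lemma contDiff_del {n : ℕ∞ω} (hf : ContDiff ℝ (n + 1) f) : ContDiff ℝ n (del v f) := by
  have h1 : ∀ w : E, ContDiff ℝ n fun q => fderiv ℝ f q w :=
    fun w => (hf.fderiv_right le_rfl).clm_apply contDiff_const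
  exact ((h1 v).sub (contDiff_const.mul (h1 _))).div_const 2

lemma contDiff_delbar {n : ℕ∞ω} (hf : ContDiff ℝ (n + 1) f) : ContDiff ℝ n (delbar v f) := by
  have h1 : ∀ w : E, ContDiff ℝ n fun q => fderiv ℝ f q w :=
    fun w => (hf.fderiv_right le_rfl).clm_apply contDiff_const
  exact ((h1 v).add (contDiff_const.mul (h1 _))).div_const 2

lemma fderiv_del (hf : ContDiff ℝ 2 f) (v w : E) :
    fderiv ℝ (del v f) p w =
      (fderiv ℝ (fderiv ℝ f) p w v - Complex.I * fderiv ℝ (fderiv ℝ f) p w (Complex.I • v)) / 2 := by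
  have hd : DifferentiableAt ℝ (fderiv ℝ f) p :=
    (hf.fderiv_right (m := 1) (by norm_num)).differentiable one_ne_zero p
  have h1 : ∀ u : E, HasFDerivAt (fun q => fderiv ℝ f q u)
      ((fderiv ℝ (fderiv ℝ f) p).flip u) p := fun u => by
    simpa using hd.hasFDerivAt.clm_apply (hasFDerivAt_const u p)
  have h2 := ((h1 v).sub ((h1 (Complex.I • v)).const_mul Complex.I)).mul_const (2⁻¹ : ℂ)
  have h3 : del v f = fun q => (fderiv ℝ f q v - Complex.I * fderiv ℝ f q (Complex.I • v)) * 2⁻¹ := by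
    ext q; simp [del, div_eq_mul_inv]
  rw [h3]
  refine (congrArg (fun L : E →L[ℝ] ℂ => L w) h2.fderiv).trans ?_
  simp
  ring

/-- Symmetry of the real second derivative. Closedness of any form with a potential rests on this.
-/
lemma del_del_comm (hf : ContDiff ℝ 2 f) (v w : E) :
    del v (del w f) p = del w (del v f) p := by
  have hs : IsSymmSndFDerivAt ℝ f p := hf.contDiffAt.isSymmSndFDerivAt (by simp)
  simp only [del.eq_1 v (del w f), del.eq_1 w (del v f), fderiv_del hf]
  rw [hs.eq v w, hs.eq (Complex.I • v) w, hs.eq v (Complex.I • w),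
    hs.eq (Complex.I • v) (Complex.I • w)]
  ring

variable {u : E → ℝ} {F : ℝ → ℝ} {F' : ℝ}

lemma delbar_ofReal (hu : DifferentiableAt ℝ u p) :
    delbar v (fun x => (u x : ℂ)) p = conj (del v (fun x => (u x : ℂ)) p) := by
  simp [del, delbar, fderiv_ofReal_comp hu, Complex.conj_ofNat]

lemma del_ofReal_chain (hu : DifferentiableAt ℝ u p) (hF : HasDerivAt F F' (u p)) :
    del v (fun x => (F (u x) : ℂ)) p = F' * del v (fun x => (u x : ℂ)) p := by
  simp only [del, fderiv_ofReal_chain hu hF]; ring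

lemma delbar_ofReal_chain (hu : DifferentiableAt ℝ u p) (hF : HasDerivAt F F' (u p)) :
    delbar v (fun x => (F (u x) : ℂ)) p = F' * delbar v (fun x => (u x : ℂ)) p := by
  simp only [delbar, fderiv_ofReal_chain hu hF]; ring

/-- The chain rule for the complex Hessian of `F ∘ u`. -/
lemma del_delbar_ofReal_chain {F₁ : ℝ → ℝ} {F₂ : ℝ} (hu : ContDiff ℝ 2 u)
    (hF : ∀ q, HasDerivAt F (F₁ (u q)) (u q)) (hF₁ : HasDerivAt F₁ F₂ (u p)) (v w : E) :
    del v (fun q => delbar w (fun x => (F (u x) : ℂ)) q) p =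
      F₂ * del v (fun x => (u x : ℂ)) p * delbar w (fun x => (u x : ℂ)) p +
        F₁ (u p) * del v (fun q => delbar w (fun x => (u x : ℂ)) q) p := by
  have hd := hu.differentiable two_ne_zero
  have h1 : (fun q => delbar w (fun x => (F (u x) : ℂ)) q) =
      fun q => (F₁ (u q) : ℂ) * delbar w (fun x => (u x : ℂ)) q :=
    funext fun q => delbar_ofReal_chain (hd q) (hF q)
  have h2 : DifferentiableAt ℝ (fun q => (F₁ (u q) : ℂ)) p :=
    Complex.ofRealCLM.differentiableAt.comp p (hF₁.differentiableAt.comp p (hd p))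
  have h3 : DifferentiableAt ℝ (fun q => delbar w (fun x => (u x : ℂ)) q) p :=
    (contDiff_delbar (n := 1) (by simpa [one_add_one_eq_two] using contDiff_ofReal_comp hu)).differentiable
      one_ne_zero p
  rw [h1, del_mul_fun h2 h3, del_ofReal_chain (hd p) hF₁]
  ring

lemma del_delbar_add {f g : E → ℂ} (hf : ContDiff ℝ 2 f) (hg : ContDiff ℝ 2 g) (v w : E) :
    del v (fun q => delbar w (fun x => f x + g x) q) p =
      del v (fun q => delbar w f q) p + del v (fun q => delbar w g q) p := by
  have h1 : (fun q => delbar w (fun x => f x + g x) q) = fun q => delbar w f q + delbar w g q :=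
    funext fun q => delbar_add_fun (hf.differentiable two_ne_zero q)
      (hg.differentiable two_ne_zero q)
  have h2 : ∀ {f : E → ℂ}, ContDiff ℝ 2 f → DifferentiableAt ℝ (fun q => delbar w f q) p :=
    fun hf => (contDiff_delbar (n := 1) (by simpa [one_add_one_eq_two] using hf)).differentiable
      one_ne_zero p
  rw [h1, del_add_fun (h2 hf) (h2 hg)]

lemma del_const_mul (c : ℂ) (hf : DifferentiableAt ℝ f p) :
    del v (fun x => c * f x) p = c * del v f p := by
  rw [del_mul_fun (by fun_prop) hf]; simp

end WirtingerCalculus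

/-! ### Derivatives of functions of one coordinate, and expansion of `del` in the standard basis. -/

section Coordinates

variable {n : ℕ} {f : ℂ → ℂ} {p : Fin n → ℂ} {i k : Fin n}

lemma fderiv_comp_coord (hf : DifferentiableAt ℝ f (p k)) (v : Fin n → ℂ) :
    fderiv ℝ (fun q : Fin n → ℂ => f (q k)) p v = fderiv ℝ f (p k) (v k) := by
  have h1 : HasFDerivAt (fun q : Fin n → ℂ => q k)
    (ContinuousLinearMap.proj (R := ℝ) (φ := fun _ => ℂ) k) p := hasFDerivAt_apply k p
  have := (hf.hasFDerivAt).comp p h1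
  refine (congrArg (fun L : (Fin n → ℂ) →L[ℝ] ℂ => L v) this.fderiv).trans ?_
  simp

lemma del_comp_coord_self (hf : DifferentiableAt ℝ f (p k)) :
    del (Pi.single k 1) (fun q : Fin n → ℂ => f (q k)) p = del 1 f (p k) := by
  simp [del, fderiv_comp_coord hf]

lemma del_comp_coord_of_ne (hf : DifferentiableAt ℝ f (p k)) (hik : i ≠ k) :
    del (Pi.single i 1) (fun q : Fin n → ℂ => f (q k)) p = 0 := by
  simp [del, fderiv_comp_coord hf, hik.symm]

lemma delbar_comp_coord_self (hf : DifferentiableAt ℝ f (p k)) :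
    delbar (Pi.single k 1) (fun q : Fin n → ℂ => f (q k)) p = delbar 1 f (p k) := by
  simp [delbar, fderiv_comp_coord hf]

lemma delbar_comp_coord_of_ne (hf : DifferentiableAt ℝ f (p k)) (hik : i ≠ k) :
    delbar (Pi.single i 1) (fun q : Fin n → ℂ => f (q k)) p = 0 := by
  simp [delbar, fderiv_comp_coord hf, hik.symm]

lemma del_eq_sum {f : (Fin n → ℂ) → ℂ} (v : Fin n → ℂ) :
    del v f p = ∑ i, v i * del (Pi.single i 1) f p := by
  -- The real derivative is only ℝ-linear; its (1,0) part is ℂ-linear in the direction, holomorphic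
  -- `f` or not.
  have hsmul : ∀ (c : ℂ) (w : Fin n → ℂ), del (c • w) f p = c * del w f p := by
    intro c w
    have h1 : c • w = c.re • w + c.im • (Complex.I • w) := by
      ext j
      simp only [Pi.smul_apply, Pi.add_apply, smul_eq_mul, Complex.real_smul]
      conv_lhs => rw [← Complex.re_add_im c]
      ring
    have h2 : Complex.I • c • w = c.re • (Complex.I • w) + (-c.im) • w := by
      ext j
      simp only [Pi.smul_apply, Pi.add_apply, smul_eq_mul, Complex.real_smul]
      conv_lhs => rw [← Complex.re_add_im c]
      push_cast
      linear_combination (c.im * w j : ℂ) * Complex.I_mul_I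
    simp only [del]
    rw [h2, h1]
    simp only [map_add, map_smul, Complex.real_smul]
    conv_rhs => rw [← Complex.re_add_im c]
    push_cast
    linear_combination (c.im * fderiv ℝ f p (Complex.I • w) / 2 : ℂ) * Complex.I_mul_I
  have hsum : ∀ s : Finset (Fin n), del (∑ i ∈ s, v i • Pi.single (M := fun _ => ℂ) i (1 : ℂ)) f p =
      ∑ i ∈ s, v i * del (Pi.single i 1) f p := by
    intro s
    classical
    induction s using Finset.induction_on with
    | empty => simp [del]
    | insert a s ha ih =>
      rw [Finset.sum_insert ha, Finset.sum_insert ha, ← ih, ← hsmul]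
      simp only [del, smul_add, map_add]
      ring
  rw [← hsum]
  congr 1
  ext j
  simp [Finset.sum_apply, Pi.single_apply]

end Coordinates

lemma hasFDerivAt_conj (z : ℂ) : HasFDerivAt (fun w : ℂ => conj w) (Complex.conjCLE : ℂ →L[ℝ] ℂ) z :=
  Complex.conjCLE.hasFDerivAt

lemma differentiable_conj : Differentiable ℝ (fun w : ℂ => conj w) :=
  fun z => (hasFDerivAt_conj z).differentiableAt

lemma del_id (z : ℂ) : del 1 (fun w : ℂ => w) z = 1 := by simp [del, Complex.I_mul_I]

lemma delbar_id (z : ℂ) : delbar 1 (fun w : ℂ => w) z = 0 := by simp [delbar, Complex.I_mul_I]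

lemma del_conj (z : ℂ) : del 1 (fun w : ℂ => conj w) z = 0 := by
  simp [del, (hasFDerivAt_conj z).fderiv]

lemma delbar_conj (z : ℂ) : delbar 1 (fun w : ℂ => conj w) z = 1 := by
  simp [delbar, (hasFDerivAt_conj z).fderiv]

/-! ## The momentum profile -/

section Profile

variable {K : ℝ}

/-- The inverse of `τ ↦ τ * exp (K * τ)` on `τ > -1/K`. It expresses the moment map of the
scalar-flat metric in terms of the squared norm function. -/
def moment (K : ℝ) : ℝ → ℝ :=
  Function.invFunOn (fun τ => τ * Real.exp (K * τ)) {τ | 0 < 1 + K * τ}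

lemma hasDerivAt_mul_exp (K τ : ℝ) :
    HasDerivAt (fun τ => τ * Real.exp (K * τ)) ((1 + K * τ) * Real.exp (K * τ)) τ := by
  have h1 : HasDerivAt (fun τ => Real.exp (K * τ)) (Real.exp (K * τ) * (K * 1)) τ :=
    ((hasDerivAt_id τ).const_mul K).exp
  convert! (hasDerivAt_id τ).mul h1 using 1
  simp; ring

lemma injOn_mul_exp (K : ℝ) :
    Set.InjOn (fun τ => τ * Real.exp (K * τ)) {τ | 0 < 1 + K * τ} := by
  have hc : Convex ℝ {τ : ℝ | 0 < 1 + K * τ} := by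
    intro x hx y hy a b ha hb hab
    simp only [Set.mem_ofPred_eq, smul_eq_mul] at *
    have : 1 + K * (a * x + b * y) = a * (1 + K * x) + b * (1 + K * y) := by
      linear_combination (-1 : ℝ) * hab
    rw [this]
    -- The weights are only nonnegative, so strict positivity needs the case `a = 0` apart.
    rcases ha.eq_or_lt with rfl | ha
    · rw [zero_add] at hab; subst hab; simpa using hy
    · exact add_pos_of_pos_of_nonneg (mul_pos ha hx) (mul_nonneg hb hy.le)
  refine (strictMonoOn_of_deriv_pos hc (by fun_prop) fun τ hτ => ?_).injOn
  rw [(hasDerivAt_mul_exp K τ).deriv]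
  have hτ' : 0 < 1 + K * τ := interior_subset (s := {τ | 0 < 1 + K * τ}) hτ
  positivity

variable (hK : 0 < K) {s : ℝ}
include hK

lemma exists_mul_exp_eq (hs : 0 ≤ s) : ∃ τ, 0 ≤ τ ∧ τ * Real.exp (K * τ) = s := by
  have h1 : s ≤ s * Real.exp (K * s) :=
    le_mul_of_one_le_right hs (Real.one_le_exp (by positivity))
  obtain ⟨τ, hτ, h⟩ := intermediate_value_Icc hs
    (f := fun τ => τ * Real.exp (K * τ)) (by fun_prop) (show s ∈ _ by simpa using ⟨hs, h1⟩)
  exact ⟨τ, hτ.1, h⟩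

lemma moment_mul_exp_of_nonneg {τ : ℝ} (hτ : 0 ≤ τ) : moment K (τ * Real.exp (K * τ)) = τ :=
  (injOn_mul_exp K).leftInvOn_invFunOn (show 0 < 1 + K * τ by positivity)

lemma moment_nonneg (hs : 0 ≤ s) : 0 ≤ moment K s := by
  obtain ⟨τ, hτ, rfl⟩ := exists_mul_exp_eq hK hs
  rwa [moment_mul_exp_of_nonneg hK hτ]

lemma moment_mul_exp (hs : 0 ≤ s) : moment K s * Real.exp (K * moment K s) = s := by
  obtain ⟨τ, hτ, rfl⟩ := exists_mul_exp_eq hK hs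
  rw [moment_mul_exp_of_nonneg hK hτ]

/-- This relation eliminates `s` and turns the later curvature and length identities into algebra in
`τ`. -/
lemma exp_neg_mul_self (hs : 0 ≤ s) : Real.exp (-(K * moment K s)) * s = moment K s := by
  have h1 := moment_mul_exp hK hs
  have h2 : Real.exp (-(K * moment K s)) * Real.exp (K * moment K s) = 1 := by
    rw [← Real.exp_add]; simp
  linear_combination (-Real.exp (-(K * moment K s))) * h1 + moment K s * h2

lemma one_add_moment_pos (hs : 0 ≤ s) : 0 < 1 + K * moment K s := by
  have := moment_nonneg hK hs; positivity

/-- The inverse function theorem applies since `1 + Kτ > 0`. The case `s = 0` is the zero section;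
it is covered because the domain of inversion contains a neighbourhood of `τ = 0`. -/
lemma contDiffAt_moment_and_eventually (hs : 0 ≤ s) : ContDiffAt ℝ ∞ (moment K) s ∧
    ∀ᶠ y in 𝓝 s, moment K y * Real.exp (K * moment K y) = y := by
  set τ := moment K s with hτ
  have hQ := one_add_moment_pos hK hs
  let e : ℝ ≃L[ℝ] ℝ := ContinuousLinearEquiv.unitsEquivAut ℝ
    (Units.mk0 ((1 + K * τ) * Real.exp (K * τ)) (mul_pos hQ (Real.exp_pos _)).ne')
  have hc : ContDiffAt ℝ ∞ (fun τ => τ * Real.exp (K * τ)) τ := by fun_prop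
  have hd : HasFDerivAt (fun τ => τ * Real.exp (K * τ)) (e : ℝ →L[ℝ] ℝ) τ := by
    convert! (hasDerivAt_mul_exp K τ).hasFDerivAt using 1
  have hsτ : τ * Real.exp (K * τ) = s := moment_mul_exp hK hs
  have hl := hc.to_localInverse hd (by simp)
  have hs' : HasStrictFDerivAt (fun τ => τ * Real.exp (K * τ)) (e : ℝ →L[ℝ] ℝ) τ :=
    hc.hasStrictFDerivAt' hd (by simp)
  have hr := hs'.eventually_right_inverse
  have ht := hs'.localInverse_tendsto
  simp only [hsτ] at hl hr ht
  have hev := ht.eventually ((isOpen_lt continuous_const (by fun_prop)).mem_nhds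
    (show τ ∈ {τ : ℝ | 0 < 1 + K * τ} from hQ))
  -- The local inverse stays in the half-line of injectivity, so it must agree with the globally
  -- chosen inverse.
  have heq : moment K =ᶠ[𝓝 s] hs'.localInverse _ _ _ := by
    filter_upwards [hr, hev] with y hy hy'
    conv_lhs => rw [← hy]
    exact (injOn_mul_exp K).leftInvOn_invFunOn hy'
  refine ⟨hl.congr_of_eventuallyEq heq, ?_⟩
  filter_upwards [hr, heq] with y hy hy'
  rw [hy', hy]

lemma contDiffAt_moment (hs : 0 ≤ s) : ContDiffAt ℝ ∞ (moment K) s :=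
  (contDiffAt_moment_and_eventually hK hs).1

lemma hasDerivAt_moment (hs : 0 ≤ s) :
    HasDerivAt (moment K) (Real.exp (-(K * moment K s)) / (1 + K * moment K s)) s := by
  have hQ := one_add_moment_pos hK hs
  have h1 := (contDiffAt_moment hK hs).continuousAt
  have h2 := (contDiffAt_moment_and_eventually hK hs).2
  have := HasDerivAt.of_local_left_inverse h1 (hasDerivAt_mul_exp K (moment K s))
    (mul_pos hQ (Real.exp_pos _)).ne' h2
  convert! this using 1
  rw [mul_inv, ← Real.exp_neg]; ring

/-- The potential of the scalar-flat metric as a function of the squared norm function. -/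
def potential (K s : ℝ) : ℝ := moment K s / 2 + K * moment K s ^ 2 / 4

lemma contDiffAt_potential (hs : 0 ≤ s) : ContDiffAt ℝ ∞ (potential K) s := by
  have := contDiffAt_moment hK hs
  unfold potential
  fun_prop

/-- The factor `1 + Kτ` cancels. Hence `2s` times the derivative is `τ`, that is, `f'(t) = τ` for `s
= e^{2t}`. -/
lemma hasDerivAt_potential (hs : 0 ≤ s) :
    HasDerivAt (potential K) (Real.exp (-(K * moment K s)) / 2) s := by
  have hQ := one_add_moment_pos hK hs
  have h := hasDerivAt_moment hK hs
  convert! (h.div_const 2).add (((h.pow 2).const_mul K).div_const 4) using 1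
  field_simp
  ring

lemma hasDerivAt_exp_neg_moment (hs : 0 ≤ s) :
    HasDerivAt (fun s => Real.exp (-(K * moment K s)))
      (-K * Real.exp (-(K * moment K s)) ^ 2 / (1 + K * moment K s)) s := by
  have h := hasDerivAt_moment hK hs
  convert! (h.const_mul K).neg.exp using 1
  simp only [Pi.neg_apply]
  ring

lemma hasDerivAt_deriv_moment (hs : 0 ≤ s) :
    HasDerivAt (fun s => Real.exp (-(K * moment K s)) / (1 + K * moment K s))
      (-K * Real.exp (-(K * moment K s)) ^ 2 * (2 + K * moment K s) / (1 + K * moment K s) ^ 3)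
      s := by
  have hQ := one_add_moment_pos hK hs
  have h := hasDerivAt_moment hK hs
  convert! (hasDerivAt_exp_neg_moment hK hs).div ((h.const_mul K).const_add 1) hQ.ne' using 1
  field_simp
  ring

end Profile

/-! ## The squared norm function and its complex Hessian -/

/-- The squared norm of `![w, z]` with respect to the Hermitian metric `h`. -/
def normSq (h : ℂ → ℝ) (p : Fin 2 → ℂ) : ℝ := h (p 1) * ‖p 0‖ ^ 2

/-- The connection coefficient `∂ log h`. -/
def connCoeff (h : ℂ → ℝ) (z : ℂ) : ℂ := del 1 (fun x => (Real.log (h x) : ℂ)) z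

/-- The matrix of the Hermitian form `a |dw + t dz|² + Q |dz|²`. -/
def blockForm (a Q : ℝ) (t : ℂ) : Matrix (Fin 2) (Fin 2) ℂ :=
  !![(a : ℂ), a * conj t; a * t, Q + a * (t * conj t)]

/-- The change of frame to `dw + t dz`, `dz` is unipotent, so `t` drops out. -/
lemma det_blockForm (a Q : ℝ) (t : ℂ) : (blockForm a Q t).det = (a * Q : ℝ) := by
  simp [blockForm, Matrix.det_fin_two]; ring

lemma blockForm_add (a b Q R : ℝ) (t : ℂ) :
    blockForm a Q t + blockForm b R t = blockForm (a + b) (Q + R) t := by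
  ext i j; fin_cases i <;> fin_cases j <;> simp [blockForm] <;> ring

lemma smul_blockForm (c a Q : ℝ) (t : ℂ) :
    (c : ℂ) • blockForm a Q t = blockForm (c * a) (c * Q) t := by
  ext i j; fin_cases i <;> fin_cases j <;> simp [blockForm] <;> ring

/-- Both forms are diagonal in the same frame, so the relative eigenvalues are the ratios of
coefficients. -/
lemma trace_inv_blockForm_mul {a Q : ℝ} (ha : a ≠ 0) (hQ : Q ≠ 0) (b R : ℝ) (t : ℂ) :
    ((blockForm a Q t)⁻¹ * blockForm b R t).trace = (b / a + R / Q : ℝ) := by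
  have ha' : (a : ℂ) ≠ 0 := by exact_mod_cast ha
  have hQ' : (Q : ℂ) ≠ 0 := by exact_mod_cast hQ
  rw [Matrix.inv_def, det_blockForm, Ring.inverse_eq_inv', Matrix.smul_mul, Matrix.trace_smul,
    Matrix.adjugate_fin_two, Matrix.trace_fin_two]
  simp [blockForm, Matrix.mul_apply, Fin.sum_univ_two]
  field_simp
  ring

lemma sum_blockForm (a Q : ℝ) (t : ℂ) (v : Fin 2 → ℂ) :
    ∑ i, ∑ j, blockForm a Q t i j * v i * conj (v j) =
      (a * ‖v 0 + t * v 1‖ ^ 2 + Q * ‖v 1‖ ^ 2 : ℝ) := by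
  push_cast
  simp only [← Complex.mul_conj', blockForm, Fin.sum_univ_two, map_add, map_mul]
  simp
  ring

lemma posDef_blockForm {a Q : ℝ} (ha : 0 < a) (hQ : 0 < Q) (t : ℂ) :
    (blockForm a Q t).PosDef := by
  refine Matrix.PosDef.of_dotProduct_mulVec_pos ?_ fun x hx => ?_
  · ext i j; fin_cases i <;> fin_cases j <;> simp [blockForm, mul_comm]
  · have h1 := sum_blockForm a Q t fun i => conj (x i)
    have h2 : star x ⬝ᵥ (blockForm a Q t).mulVec x =
        ∑ i, ∑ j, blockForm a Q t i j * conj (x i) * conj (conj (x j)) := by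
      simp [dotProduct, Matrix.mulVec, Fin.sum_univ_two]
      ring
    rw [h2, h1, Complex.zero_lt_real]
    by_cases h : x 1 = 0
    · have h0 : x 0 ≠ 0 := fun h0 => hx (by ext i; fin_cases i <;> simp [h, h0])
      simp [h]; positivity
    · have : 0 < ‖x 1‖ := norm_pos_iff.2 h
      simp only [Complex.norm_conj]
      positivity

section Hessian

variable {h : ℂ → ℝ} {K : ℝ}

lemma normSq_nonneg (h_pos : ∀ z, 0 < h z) (p : Fin 2 → ℂ) : 0 ≤ normSq h p :=
  mul_nonneg (h_pos _).le (by positivity)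

lemma contDiff_normSq (h_smooth : ContDiff ℝ ∞ h) : ContDiff ℝ ∞ (normSq h) := by
  have h0 : ∀ i : Fin 2, ContDiff ℝ ∞ fun p : Fin 2 → ℂ => p i := fun i => by fun_prop
  exact (h_smooth.comp (h0 1)).mul ((h0 0).norm_sq ℝ)

lemma ofReal_normSq (p : Fin 2 → ℂ) :
    (normSq h p : ℂ) = (h (p 1) : ℂ) * (p 0 * conj (p 0)) := by
  rw [Complex.mul_conj', normSq]; push_cast; rfl

variable (h_smooth : ContDiff ℝ ∞ h) (h_pos : ∀ z, 0 < h z)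

include h_smooth h_pos in
lemma contDiff_log_comp : ContDiff ℝ ∞ fun z => Real.log (h z) :=
  h_smooth.log fun z => (h_pos z).ne'

include h_smooth h_pos

/-- Chain rule for `h = exp (log h)`; the curvature hypothesis concerns `log h`. -/
lemma del_ofReal_eq (z : ℂ) : del 1 (fun x => (h x : ℂ)) z = h z * connCoeff h z := by
  have hl := (contDiff_log_comp h_smooth h_pos).differentiable (by simp) z
  have := del_ofReal_chain (v := 1) hl (Real.hasDerivAt_exp _)
  simp only [Real.exp_log (h_pos _)] at this
  exact this

lemma delbar_ofReal_eq (z : ℂ) :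
    delbar 1 (fun x => (h x : ℂ)) z = h z * conj (connCoeff h z) := by
  rw [delbar_ofReal (h_smooth.differentiable (by simp) z), del_ofReal_eq h_smooth h_pos]
  simp

lemma del_delbar_ofReal_eq
    (h_curv : ∀ z, del 1 (delbar 1 fun x => (Real.log (h x) : ℂ)) z = (K / 2 : ℝ)) (z : ℂ) :
    del 1 (delbar 1 fun x => (h x : ℂ)) z =
      h z * (connCoeff h z * conj (connCoeff h z) + K / 2) := by
  have hs := contDiff_log_comp h_smooth h_pos
  have := del_delbar_ofReal_chain (p := z) (F := Real.exp) (F₁ := Real.exp)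
    (contDiff_infty.1 hs 2)
    (fun q => Real.hasDerivAt_exp _) (Real.hasDerivAt_exp _) 1 1
  simp only [Real.exp_log (h_pos _)] at this
  refine this.trans ?_
  rw [delbar_ofReal (hs.differentiable (by simp) z)]
  rw [show del 1 (fun q => delbar 1 (fun x => (Real.log (h x) : ℂ)) q) z = _ from h_curv z]
  simp only [connCoeff]
  push_cast
  ring

lemma del_normSq (p : Fin 2 → ℂ) (i : Fin 2) :
    del (Pi.single i 1) (fun q => (normSq h q : ℂ)) p =
      h (p 1) * conj (p 0) * (![1, p 0 * connCoeff h (p 1)] : Fin 2 → ℂ) i := by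
  have hh : Differentiable ℝ fun z => (h z : ℂ) :=
    (contDiff_ofReal_comp h_smooth).differentiable (by simp)
  have hw : Differentiable ℝ fun w : ℂ => w * conj w :=
    differentiable_id.mul differentiable_conj
  have hp : ∀ k : Fin 2, DifferentiableAt ℝ (fun q : Fin 2 → ℂ => q k) p := fun k => by fun_prop
  have hw1 : del 1 (fun w : ℂ => w * conj w) (p 0) = conj (p 0) := by
    rw [del_mul_fun (by fun_prop) (differentiable_conj _), del_id, del_conj]; simp
  have e := del_mul_fun (v := Pi.single i 1) (f := fun q : Fin 2 → ℂ => (h (q 1) : ℂ))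
    (g := fun q => q 0 * conj (q 0)) ((hh _).comp p (hp 1)) ((hw _).comp p (hp 0))
  simp only [ofReal_normSq]
  rw [e]
  fin_cases i
  · simp only [Fin.zero_eta]
    rw [del_comp_coord_of_ne (hh _) (by decide), del_comp_coord_self (f := fun w => w * conj w)
      (hw _), hw1]
    simp
  · simp only [Fin.mk_one]
    rw [del_comp_coord_self (hh _), del_comp_coord_of_ne (f := fun w => w * conj w)
      (hw _) (by decide), del_ofReal_eq h_smooth h_pos]
    simp
    ring

lemma delbar_normSq (p : Fin 2 → ℂ) (i : Fin 2) :
    delbar (Pi.single i 1) (fun q => (normSq h q : ℂ)) p =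
      h (p 1) * p 0 * conj ((![1, p 0 * connCoeff h (p 1)] : Fin 2 → ℂ) i) := by
  rw [delbar_ofReal ((contDiff_normSq h_smooth).differentiable (by simp) p),
    del_normSq h_smooth h_pos]
  simp

lemma complexHessian_normSq
    (h_curv : ∀ z, del 1 (delbar 1 fun x => (Real.log (h x) : ℂ)) z = (K / 2 : ℝ))
    (p : Fin 2 → ℂ) :
    complexHessian (normSq h) p =
      blockForm (h (p 1)) (normSq h p * K / 2) (p 0 * connCoeff h (p 1)) := by
  have hc := contDiff_ofReal_comp h_smooth
  have hh : Differentiable ℝ fun z => (h z : ℂ) := hc.differentiable (by simp)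
  have hb : Differentiable ℝ (delbar 1 fun z => (h z : ℂ)) :=
    (contDiff_delbar (n := ∞) hc).differentiable (by simp)
  have hw : Differentiable ℝ fun w : ℂ => w * conj w :=
    differentiable_id.mul differentiable_conj
  have hp : ∀ (k : Fin 2) q, DifferentiableAt ℝ (fun q : Fin 2 → ℂ => q k) q :=
    fun k q => by fun_prop
  have hw1 : del 1 (fun w : ℂ => w * conj w) (p 0) = conj (p 0) := by
    rw [del_mul_fun (by fun_prop) (differentiable_conj _), del_id, del_conj]; simp
  have hw2 : ∀ w, delbar 1 (fun w : ℂ => w * conj w) w = w := fun w => by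
    rw [delbar_mul_fun (by fun_prop) (differentiable_conj _), delbar_id, delbar_conj]; simp
  have e0 : (fun q => delbar (Pi.single 0 1) (fun x => (normSq h x : ℂ)) q) =
      fun q => (h (q 1) : ℂ) * q 0 := by
    ext q; rw [delbar_normSq h_smooth h_pos]; simp
  have e1 : (fun q => delbar (Pi.single 1 1) (fun x => (normSq h x : ℂ)) q) =
      fun q => delbar 1 (fun z => (h z : ℂ)) (q 1) * (q 0 * conj (q 0)) := by
    ext q; rw [delbar_normSq h_smooth h_pos, delbar_ofReal_eq h_smooth h_pos]; simp; ring
  have d0 : ∀ i, del (Pi.single i 1) (fun q : Fin 2 → ℂ => (h (q 1) : ℂ) * q 0) p =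
      h (p 1) * del (Pi.single i 1) (fun q : Fin 2 → ℂ => q 0) p +
        p 0 * del (Pi.single i 1) (fun q : Fin 2 → ℂ => (h (q 1) : ℂ)) p :=
    fun i => del_mul_fun ((hh _).comp p (hp 1 p)) (hp 0 p)
  have d1 : ∀ i, del (Pi.single i 1)
      (fun q : Fin 2 → ℂ => delbar 1 (fun z => (h z : ℂ)) (q 1) * (q 0 * conj (q 0))) p =
      delbar 1 (fun z => (h z : ℂ)) (p 1) *
          del (Pi.single i 1) (fun q : Fin 2 → ℂ => q 0 * conj (q 0)) p +
        p 0 * conj (p 0) *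
          del (Pi.single i 1) (fun q : Fin 2 → ℂ => delbar 1 (fun z => (h z : ℂ)) (q 1)) p :=
    fun i => del_mul_fun ((hb _).comp p (hp 1 p)) ((hw _).comp p (hp 0 p))
  have hid : DifferentiableAt ℝ (fun w : ℂ => w) (p 0) := by fun_prop
  ext i j
  simp only [complexHessian, Matrix.of_apply]
  fin_cases i <;> fin_cases j <;>
    simp only [Fin.zero_eta, Fin.mk_one, e0, e1, d0, d1]
  · rw [del_comp_coord_self (f := fun w => w) hid,
      del_comp_coord_of_ne (f := fun z => (h z : ℂ)) (hh _) (by decide), del_id]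
    simp [blockForm]
  · rw [del_comp_coord_self (f := fun w => w * conj w) (hw _),
      del_comp_coord_of_ne (f := delbar 1 fun z => (h z : ℂ)) (hb _) (by decide), hw1,
      delbar_ofReal_eq h_smooth h_pos]
    simp [blockForm]; ring
  · rw [del_comp_coord_of_ne (f := fun w => w) hid (by decide),
      del_comp_coord_self (f := fun z => (h z : ℂ)) (hh _), del_ofReal_eq h_smooth h_pos]
    simp [blockForm]; ring
  · rw [del_comp_coord_of_ne (f := fun w => w * conj w) (hw _) (by decide),
      del_comp_coord_self (f := delbar 1 fun z => (h z : ℂ)) (hb _),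
      del_delbar_ofReal_eq h_smooth h_pos h_curv]
    simp [blockForm, ofReal_normSq]; ring

/-- Since `∂s = h w̄ (dw + w ∂log h dz)`, the rank-one term `F'' ∂s ∂̄s` affects only the fibre
coefficient, and the constant curvature of `h` gives the base coefficient. Every function of `s` is
therefore diagonalised by the same frame. -/
lemma complexHessian_comp_normSq
    (h_curv : ∀ z, del 1 (delbar 1 fun x => (Real.log (h x) : ℂ)) z = (K / 2 : ℝ))
    {F F₁ : ℝ → ℝ} {F₂ : ℝ} {p : Fin 2 → ℂ}
    (hF : ∀ s, 0 ≤ s → HasDerivAt F (F₁ s) s) (hF₁ : HasDerivAt F₁ F₂ (normSq h p)) :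
    complexHessian (fun q => F (normSq h q)) p =
      blockForm ((F₂ * normSq h p + F₁ (normSq h p)) * h (p 1))
        (F₁ (normSq h p) * normSq h p * K / 2) (p 0 * connCoeff h (p 1)) := by
  have hs : ContDiff ℝ 2 (normSq h) := contDiff_infty.1 (contDiff_normSq h_smooth) 2
  have e : ∀ i j, complexHessian (fun q => F (normSq h q)) p i j =
      F₂ * del (Pi.single i 1) (fun q => (normSq h q : ℂ)) p *
          delbar (Pi.single j 1) (fun q => (normSq h q : ℂ)) p +
        F₁ (normSq h p) * complexHessian (normSq h) p i j := fun i j =>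
    del_delbar_ofReal_chain hs (fun q => hF _ (normSq_nonneg h_pos q)) hF₁ _ _
  ext i j
  rw [e, complexHessian_normSq h_smooth h_pos h_curv, del_normSq h_smooth h_pos,
    delbar_normSq h_smooth h_pos]
  fin_cases i <;> fin_cases j <;> simp [blockForm, ofReal_normSq] <;> ring

end Hessian

/-! ## The scalar-flat metric -/

section Metric

variable {h : ℂ → ℝ} {K : ℝ} (hK : 0 < K) (h_smooth : ContDiff ℝ ∞ h) (h_pos : ∀ z, 0 < h z)
  (h_curv : ∀ z, del 1 (delbar 1 fun x => (Real.log (h x) : ℂ)) z = (K / 2 : ℝ))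

/-- The moment map of the circle action on the total space. -/
def momentMap (K : ℝ) (h : ℂ → ℝ) (p : Fin 2 → ℂ) : ℝ := moment K (normSq h p)

/-- The squared length of the fibre direction. -/
def fibreCoeff (K : ℝ) (h : ℂ → ℝ) (p : Fin 2 → ℂ) : ℝ :=
  2 * h (p 1) * Real.exp (-(K * momentMap K h p)) / (1 + K * momentMap K h p)

/-- The components of the metric obtained from the Calabi ansatz with the given potential. -/
def calabiCoeff (K : ℝ) (h : ℂ → ℝ) (p : Fin 2 → ℂ) : Matrix (Fin 2) (Fin 2) ℂ :=
  Matrix.single 1 1 1 + (4 : ℂ) • complexHessian (fun q => potential K (normSq h q)) p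

lemma single_one_eq_blockForm (c : ℝ) (t : ℂ) :
    Matrix.single 1 1 (c : ℂ) = blockForm 0 c t := by
  ext i j; fin_cases i <;> fin_cases j <;> simp [blockForm]

include h_smooth h_pos in
lemma contDiff_comp_normSq {F : ℝ → ℝ} (hF : ∀ s, 0 ≤ s → ContDiffAt ℝ ∞ F s) :
    ContDiff ℝ ∞ fun p => F (normSq h p) :=
  contDiff_iff_contDiffAt.2 fun p =>
    (hF _ (normSq_nonneg h_pos p)).comp p (contDiff_normSq h_smooth).contDiffAt

include hK h_pos

lemma momentMap_nonneg (p : Fin 2 → ℂ) : 0 ≤ momentMap K h p :=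
  moment_nonneg hK (normSq_nonneg h_pos p)

lemma one_add_momentMap_pos (p : Fin 2 → ℂ) : 0 < 1 + K * momentMap K h p :=
  one_add_moment_pos hK (normSq_nonneg h_pos p)

lemma exp_mul_normSq (p : Fin 2 → ℂ) :
    Real.exp (-(K * momentMap K h p)) * normSq h p = momentMap K h p :=
  exp_neg_mul_self hK (normSq_nonneg h_pos p)

lemma fibreCoeff_pos (p : Fin 2 → ℂ) : 0 < fibreCoeff K h p := by
  have h1 := h_pos (p 1)
  have h2 := one_add_momentMap_pos hK h_pos p
  unfold fibreCoeff
  positivity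

include h_smooth

lemma contDiff_momentMap : ContDiff ℝ ∞ (momentMap K h) :=
  contDiff_comp_normSq h_smooth h_pos fun _ hs => contDiffAt_moment hK hs

lemma contDiff_hessian_potential (i j : Fin 2) : ContDiff ℝ ∞
    fun p => complexHessian (fun q => potential K (normSq h q)) p i j := by
  have h1 := contDiff_comp_normSq h_smooth h_pos fun _ hs => contDiffAt_potential hK hs
  exact contDiff_del (n := ∞) (contDiff_delbar (n := ∞) (contDiff_ofReal_comp h1))

include h_curv

lemma calabiCoeff_eq (p : Fin 2 → ℂ) :
    calabiCoeff K h p =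
      blockForm (fibreCoeff K h p) (1 + K * momentMap K h p) (p 0 * connCoeff h (p 1)) := by
  have hs := normSq_nonneg h_pos p
  have hQ := one_add_momentMap_pos hK h_pos p
  have hE := exp_mul_normSq hK h_pos p
  rw [calabiCoeff, complexHessian_comp_normSq h_smooth h_pos h_curv
    (fun s hs => hasDerivAt_potential hK hs) ((hasDerivAt_exp_neg_moment hK hs).div_const 2),
    show (4 : ℂ) = ((4 : ℝ) : ℂ) by simp, smul_blockForm,
    show (1 : ℂ) = ((1 : ℝ) : ℂ) by simp, single_one_eq_blockForm, blockForm_add]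
  simp only [fibreCoeff, ← momentMap.eq_1] at *
  congr 1
  · field_simp
    linear_combination (-(4 * K * h (p 1)) : ℝ) * Real.exp (-(K * momentMap K h p)) * hE
  · linear_combination K * hE

/-- The scalar-flat Kähler metric on the total space of a negative line bundle of constant
curvature over the flat plane. -/
def calabiMetric : KahlerMetric 2 where
  coeff := calabiCoeff K h
  smooth i j := contDiff_const.add
    (contDiff_const.mul (contDiff_hessian_potential hK h_smooth h_pos i j))
  posDef p := by
    rw [calabiCoeff_eq hK h_smooth h_pos h_curv]
    exact posDef_blockForm (fibreCoeff_pos hK h_pos p) (one_add_momentMap_pos hK h_pos p) _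
  closed i j l p := by
    have h1 := contDiff_comp_normSq h_smooth h_pos fun _ hs => contDiffAt_potential hK hs
    have h2 : ∀ i l, del (Pi.single l 1) (fun q => calabiCoeff K h q i j) p =
        4 * del (Pi.single l 1)
          (fun q => complexHessian (fun q => potential K (normSq h q)) q i j) p := fun i l => by
      have hd := (contDiff_hessian_potential hK h_smooth h_pos i j).differentiable (by simp) p
      have := del_add_fun (v := Pi.single l 1) (p := p)
        (differentiableAt_const ((Matrix.single 1 1 1 : Matrix (Fin 2) (Fin 2) ℂ) i j))
        (hd.const_mul (4 : ℂ))
      rw [del_const, zero_add, del_const_mul _ hd] at this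
      exact this
    rw [h2, h2]
    congr 1
    exact del_del_comm (contDiff_infty.1
      (contDiff_delbar (n := ∞) (contDiff_ofReal_comp h1)) 2) _ _

lemma isBundleAdapted_calabiMetric :
    (calabiMetric hK h_smooth h_pos h_curv).IsBundleAdapted h := by
  refine ⟨fun t => potential K (Real.exp (2 * t)), ?_, fun p hp => ?_⟩
  · refine contDiff_iff_contDiffAt.2 fun t => ?_
    exact (contDiffAt_potential hK (Real.exp_pos _).le).comp t
      (f := fun t => Real.exp (2 * t)) (by fun_prop)
  · have hev : ∀ᶠ q : Fin 2 → ℂ in 𝓝 p, q 0 ≠ 0 :=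
      (isOpen_ne_fun (continuous_apply 0) continuous_const).mem_nhds hp
    have heq : ∀ q : Fin 2 → ℂ, q 0 ≠ 0 → Real.exp (2 * logNorm h q) = normSq h q := by
      intro q hq
      have := h_pos (q 1)
      rw [logNorm, mul_div_cancel₀ _ two_ne_zero, Real.exp_log (by positivity), normSq]
    change calabiCoeff K h p = _
    rw [calabiCoeff]
    congr 2
    ext i j
    -- The potentials agree only off the zero section; that set is open, so their second derivatives
    -- agree there.
    refine del_congr ?_
    filter_upwards [hev.eventually_nhds] with q hq
    refine delbar_congr ?_
    filter_upwards [hq] with x hx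
    rw [heq x hx]

/-- The factor `1 + Kτ` cancels in the determinant, leaving `log det = log h + log 2 - Kτ`: a
function of the base with Hessian `K/2`, plus a function of `s`. -/
lemma ricci_calabiMetric (p : Fin 2 → ℂ) :
    (calabiMetric hK h_smooth h_pos h_curv).ricci p =
      blockForm (K * h (p 1) * Real.exp (-(K * momentMap K h p)) / (1 + K * momentMap K h p) ^ 3)
        (-(K / (2 * (1 + K * momentMap K h p)))) (p 0 * connCoeff h (p 1)) := by
  have hs := normSq_nonneg h_pos p
  have hQ := one_add_momentMap_pos hK h_pos p
  have hE := exp_mul_normSq hK h_pos p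
  have hl := contDiff_log_comp h_smooth h_pos
  have hl' : ContDiff ℝ ∞ fun z => Real.log (h z) + Real.log 2 := hl.add contDiff_const
  have hlog : (fun q => Real.log ((calabiMetric hK h_smooth h_pos h_curv).coeff q).det.re) =
      fun q => (Real.log (h (q 1)) + Real.log 2) + -K * moment K (normSq h q) := by
    ext q
    have hQ := one_add_momentMap_pos hK h_pos q
    have h1 := h_pos (q 1)
    change Real.log (calabiCoeff K h q).det.re = _
    rw [calabiCoeff_eq hK h_smooth h_pos h_curv, det_blockForm, Complex.ofReal_re, fibreCoeff,
      div_mul_cancel₀ _ hQ.ne', Real.log_mul (by positivity) (Real.exp_pos _).ne',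
      Real.log_mul two_ne_zero h1.ne', Real.log_exp, momentMap]
    ring
  have hd : ∀ {f : ℂ → ℂ}, ContDiff ℝ ∞ f → Differentiable ℝ f := fun hf =>
    hf.differentiable (by simp)
  have hbase : complexHessian (fun q : Fin 2 → ℂ => Real.log (h (q 1)) + Real.log 2) p =
      blockForm 0 (K / 2) (p 0 * connCoeff h (p 1)) := by
    have hc := contDiff_ofReal_comp hl'
    have hb := contDiff_delbar (n := ∞) (v := 1) hc
    have e0 : (fun q => delbar (Pi.single 0 1)
        (fun x : Fin 2 → ℂ => ((Real.log (h (x 1)) + Real.log 2 : ℝ) : ℂ)) q) = fun _ => 0 := by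
      ext q
      exact delbar_comp_coord_of_ne (f := fun z => ((Real.log (h z) + Real.log 2 : ℝ) : ℂ))
        (hd hc _) (by decide)
    have e1 : (fun q => delbar (Pi.single 1 1)
        (fun x : Fin 2 → ℂ => ((Real.log (h (x 1)) + Real.log 2 : ℝ) : ℂ)) q) =
        fun q => delbar 1 (fun z => ((Real.log (h z) + Real.log 2 : ℝ) : ℂ)) (q 1) := by
      ext q
      exact delbar_comp_coord_self (f := fun z => ((Real.log (h z) + Real.log 2 : ℝ) : ℂ)) (hd hc _)
    have e2 : delbar 1 (fun z => ((Real.log (h z) + Real.log 2 : ℝ) : ℂ)) =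
        delbar 1 fun z => (Real.log (h z) : ℂ) := by
      ext z
      push_cast
      rw [delbar_add_fun (hd (contDiff_ofReal_comp hl) z) (differentiableAt_const _), delbar_const,
        add_zero]
    rw [e2] at hb
    rw [← single_one_eq_blockForm]
    ext i j
    simp only [complexHessian, Matrix.of_apply]
    fin_cases i <;> fin_cases j <;> simp only [Fin.zero_eta, Fin.mk_one, e0, e1, e2, del_const]
    · simp
    · rw [del_comp_coord_of_ne (f := delbar 1 fun z => (Real.log (h z) : ℂ)) (hd hb _) (by decide)]
      simp
    · simp
    · rw [del_comp_coord_self (f := delbar 1 fun z => (Real.log (h z) : ℂ)) (hd hb _), h_curv]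
      simp
  have hfib := complexHessian_comp_normSq h_smooth h_pos h_curv (p := p)
    (F := fun s => -K * moment K s) (fun s hs => (hasDerivAt_moment hK hs).const_mul (-K))
    ((hasDerivAt_deriv_moment hK hs).const_mul (-K))
  have hadd : complexHessian
      (fun q => (Real.log (h (q 1)) + Real.log 2) + -K * moment K (normSq h q)) p =
      complexHessian (fun q : Fin 2 → ℂ => Real.log (h (q 1)) + Real.log 2) p +
        complexHessian (fun q => -K * moment K (normSq h q)) p := by
    ext i j
    simp only [complexHessian, Matrix.of_apply, Matrix.add_apply, Complex.ofReal_add _ (_ * _)]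
    have h1 : ContDiff ℝ ∞ fun q : Fin 2 → ℂ => Real.log (h (q 1)) + Real.log 2 :=
      hl'.comp (contDiff_apply ℝ ℂ (1 : Fin 2))
    have h2 : ContDiff ℝ ∞ fun q => -K * moment K (normSq h q) :=
      contDiff_const.mul (contDiff_momentMap hK h_smooth h_pos)
    exact del_delbar_add (contDiff_infty.1 (contDiff_ofReal_comp h1) 2)
      (contDiff_infty.1 (contDiff_ofReal_comp h2) 2) _ _
  rw [KahlerMetric.ricci, hlog, hadd, hbase, hfib, blockForm_add, ← neg_one_smul ℂ,
    show (-1 : ℂ) = ((-1 : ℝ) : ℂ) by simp, smul_blockForm]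
  simp only [← momentMap.eq_1] at *
  congr 1
  · field_simp
    linear_combination (-(K ^ 2 * h (p 1)) * (2 + K * momentMap K h p)) *
      Real.exp (-(K * momentMap K h p)) * hE
  · field_simp
    linear_combination K * hE

/-- The relative Ricci eigenvalues are `±K / (2(1 + Kτ)²)`: positive along the fibre, negative along
the base. -/
lemma isScalarFlat_calabiMetric : (calabiMetric hK h_smooth h_pos h_curv).IsScalarFlat := by
  intro p
  have hQ := one_add_momentMap_pos hK h_pos p
  have ha := fibreCoeff_pos hK h_pos p
  have h1 := h_pos (p 1)
  rw [KahlerMetric.scalarCurvature, ricci_calabiMetric,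
    show (calabiMetric hK h_smooth h_pos h_curv).coeff p = _ from
      calabiCoeff_eq hK h_smooth h_pos h_curv p, trace_inv_blockForm_mul ha.ne' hQ.ne']
  rw [mul_eq_zero]
  right
  rw [Complex.ofReal_eq_zero, fibreCoeff]
  field_simp
  ring

lemma not_isRicciFlat_calabiMetric : ¬ (calabiMetric hK h_smooth h_pos h_curv).IsRicciFlat := by
  intro hR
  have hQ := one_add_momentMap_pos hK h_pos 0
  have h1 := h_pos 0
  have h2 := congrFun (congrFun (hR 0) 0) 0
  rw [ricci_calabiMetric, blockForm] at h2
  simp only [Matrix.of_apply, Matrix.cons_val_zero, Matrix.zero_apply, Complex.ofReal_eq_zero] at h2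
  exact absurd h2 (by simp only [Pi.zero_apply]; positivity)

lemma tangentNorm_calabiMetric (p v : Fin 2 → ℂ) :
    (calabiMetric hK h_smooth h_pos h_curv).tangentNorm p v =
      √(fibreCoeff K h p * ‖v 0 + p 0 * connCoeff h (p 1) * v 1‖ ^ 2 +
        (1 + K * momentMap K h p) * ‖v 1‖ ^ 2) := by
  rw [KahlerMetric.tangentNorm, show (calabiMetric hK h_smooth h_pos h_curv).coeff p = _ from
      calabiCoeff_eq hK h_smooth h_pos h_curv p, sum_blockForm, Complex.ofReal_re]

end Metric

/-! ## The Riemannian distance of a Kähler metric -/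

namespace KahlerMetric

variable {n : ℕ} (g : KahlerMetric n)

/-- The norm on the tangent spaces that defines `KahlerMetric.edist`. -/
abbrev tangentENorm : ∀ x : Fin n → ℂ, ENorm (TangentSpace 𝓘(ℝ, Fin n → ℂ) x) :=
  fun x => ⟨fun v => ENNReal.ofReal (g.tangentNorm x v)⟩

lemma tangentNorm_nonneg (p v : Fin n → ℂ) : 0 ≤ g.tangentNorm p v := Real.sqrt_nonneg _

lemma tangentNorm_smul (p v : Fin n → ℂ) (r : ℝ) :
    g.tangentNorm p (r • v) = |r| * g.tangentNorm p v := by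
  have h1 : ∑ i, ∑ j, g.coeff p i j * (r • v) i * conj ((r • v) j) =
      ((r ^ 2 : ℝ) : ℂ) * ∑ i, ∑ j, g.coeff p i j * v i * conj (v j) := by
    simp only [Finset.mul_sum]
    refine Finset.sum_congr rfl fun i _ => Finset.sum_congr rfl fun j _ => ?_
    simp
    ring
  rw [tangentNorm, h1, Complex.re_ofReal_mul, Real.sqrt_mul (sq_nonneg r), Real.sqrt_sq_eq_abs,
    tangentNorm]

lemma tangentNorm_le (p v : Fin n → ℂ) :
    g.tangentNorm p v ≤ √(∑ i, ∑ j, ‖g.coeff p i j‖) * ‖v‖ := by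
  rw [tangentNorm, ← Real.sqrt_sq (norm_nonneg v), ← Real.sqrt_mul (by positivity)]
  refine Real.sqrt_le_sqrt ((Complex.re_le_norm _).trans ?_)
  rw [Finset.sum_mul]
  refine norm_sum_le_of_le _ fun i _ => ?_
  rw [Finset.sum_mul]
  refine norm_sum_le_of_le _ fun j _ => ?_
  rw [norm_mul, norm_mul, Complex.norm_conj, mul_assoc, sq]
  gcongr
  · exact norm_le_pi_norm v i
  · exact norm_le_pi_norm v j

/-- Homogeneity underlies the invariance of path length under reparametrisation, on which the
triangle inequality depends. -/
lemma enormSMulClass_tangentSpace :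
    let _ := g.tangentENorm
    ∀ x : Fin n → ℂ, ENormSMulClass ℝ (TangentSpace 𝓘(ℝ, Fin n → ℂ) x) := by
  intro _ x
  have h : ∀ (r : ℝ) (v : Fin n → ℂ),
      ENNReal.ofReal (g.tangentNorm x (r • v)) = ‖r‖ₑ * ENNReal.ofReal (g.tangentNorm x v) :=
    fun r v => by
      rw [tangentNorm_smul, ENNReal.ofReal_mul (abs_nonneg r), Real.enorm_eq_ofReal_abs]
  exact ⟨h⟩

lemma edist_triangle (p q r : Fin n → ℂ) : g.edist p r ≤ g.edist p q + g.edist q r := by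
  let := g.tangentENorm
  have := g.enormSMulClass_tangentSpace
  exact Manifold.riemannianEDist_triangle

/-- A function whose derivative is bounded by the metric is Lipschitz for the distance. -/
lemma enorm_sub_le_of_edist_lt {F : Type*} [NormedAddCommGroup F] [NormedSpace ℝ F]
    {ψ : (Fin n → ℂ) → F} (hψ : ContDiff ℝ 1 ψ) {C : ℝ} (hC : 0 ≤ C)
    (hbound : ∀ p v, ‖fderiv ℝ ψ p v‖ ≤ C * g.tangentNorm p v) {p q : Fin n → ℂ} {r : ℝ≥0∞}
    (hr : g.edist p q < r) : ‖ψ q - ψ p‖ₑ ≤ ENNReal.ofReal C * r := by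
  let := g.tangentENorm
  obtain ⟨γ, h0, h1, hγ, hlen⟩ := Manifold.exists_lt_of_riemannianEDist_lt
    (I := 𝓘(ℝ, Fin n → ℂ)) (x := p) (y := q) hr
  rw [contMDiffOn_iff_contDiffOn] at hγ
  rw [Manifold.pathELength_eq_lintegral_mfderiv_Ioo] at hlen
  have h2 := enorm_sub_le_lintegral_deriv_of_contDiffOn_Icc (hψ.comp_contDiffOn hγ) zero_le_one
  simp only [Function.comp_apply, h0, h1] at h2
  refine h2.trans (le_trans ?_ (mul_le_mul_right hlen.le _))
  rw [← MeasureTheory.lintegral_const_mul' _ _ ENNReal.ofReal_ne_top,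
    ← MeasureTheory.restrict_Ioo_eq_restrict_Icc]
  refine MeasureTheory.setLIntegral_mono' measurableSet_Ioo fun t ht => ?_
  have hd : DifferentiableAt ℝ γ t :=
    ((hγ t ⟨ht.1.le, ht.2.le⟩).contDiffAt (Icc_mem_nhds ht.1 ht.2)).differentiableAt one_ne_zero
  rw [mfderiv_eq_fderiv]
  change ‖deriv (ψ ∘ γ) t‖ₑ ≤
    ENNReal.ofReal C * ENNReal.ofReal (g.tangentNorm (γ t) (fderiv ℝ γ t 1))
  rw [← ENNReal.ofReal_mul hC, ← ofReal_norm,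
    fderiv_comp_deriv t (hψ.differentiable one_ne_zero _) hd]
  exact ENNReal.ofReal_le_ofReal (hbound _ _)

/-- Near a point, the Riemannian distance is bounded by a multiple of the Euclidean one. -/
lemma exists_edist_le (p : Fin n → ℂ) : ∃ C : ℝ, ∀ q ∈ Metric.closedBall p 1,
    g.edist q p ≤ ENNReal.ofReal (C * ‖p - q‖) := by
  have hcont : Continuous fun x => √(∑ i, ∑ j, ‖g.coeff x i j‖) := by
    refine Real.continuous_sqrt.comp (continuous_finsetSum _ fun i _ =>
      continuous_finsetSum _ fun j _ => (g.smooth i j).continuous.norm)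
  obtain ⟨C, hC⟩ := ((isCompact_closedBall p 1).bddAbove_image hcont.continuousOn)
  refine ⟨C, fun q hq => ?_⟩
  let := g.tangentENorm
  have := g.enormSMulClass_tangentSpace
  let γ : ℝ → Fin n → ℂ := fun t => q + t • (p - q)
  have hγ : ContDiff ℝ 1 γ := by fun_prop
  have h1 := Manifold.riemannianEDist_le_pathELength (I := 𝓘(ℝ, Fin n → ℂ)) (γ := γ) (a := 0)
    (b := 1) (x := q) (y := p) (contMDiffOn_iff_contDiffOn.2 hγ.contDiffOn) (by simp [γ])
    (by simp [γ]) zero_le_one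
  refine h1.trans ?_
  rw [Manifold.pathELength_eq_lintegral_mfderiv_Icc]
  have h2 : ∀ t ∈ Set.Icc (0 : ℝ) 1,
      ENNReal.ofReal (g.tangentNorm (γ t) (fderiv ℝ γ t 1)) ≤ ENNReal.ofReal (C * ‖p - q‖) := by
    intro t ht
    have hd : HasDerivAt γ (p - q) t := by
      have := ((hasDerivAt_id t).smul_const (p - q)).const_add q
      rwa [one_smul] at this
    have hmem : γ t ∈ Metric.closedBall p 1 :=
      (convex_closedBall p 1).add_smul_sub_mem hq (Metric.mem_closedBall_self zero_le_one) ht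
    have h3 : fderiv ℝ γ t 1 = p - q := by rw [fderiv_apply_one_eq_deriv, hd.deriv]
    rw [h3]
    refine ENNReal.ofReal_le_ofReal ((g.tangentNorm_le _ _).trans ?_)
    gcongr
    exact hC (Set.mem_image_of_mem _ hmem)
  refine (MeasureTheory.setLIntegral_mono' (g := fun _ => ENNReal.ofReal (C * ‖p - q‖))
    measurableSet_Icc fun t ht => ?_).trans ?_
  · rw [mfderiv_eq_fderiv]
    exact h2 t ht
  · simp

/-- A Kähler metric with a proper function of bounded derivative is complete. -/
lemma isComplete_of_bounded_fderiv {F : Type*} [NormedAddCommGroup F] [NormedSpace ℝ F]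
    {ψ : (Fin n → ℂ) → F} (hψ : ContDiff ℝ 1 ψ) {C : ℝ} (hC : 0 ≤ C)
    (hbound : ∀ p v, ‖fderiv ℝ ψ p v‖ ≤ C * g.tangentNorm p v)
    (hproper : ∀ R : ℝ, Bornology.IsBounded {p | ‖ψ p‖ ≤ R}) : g.IsComplete := by
  intro u hu
  -- Taking `ε = 1` confines the tail from `N` on to a sublevel set of `‖ψ‖`, bounded by properness;
  -- a Euclidean convergent subsequence then exists.
  obtain ⟨N, hN⟩ := hu 1 one_pos
  have hmem : ∀ k, u (k + N) ∈ {p | ‖ψ p‖ ≤ ‖ψ (u N)‖ + C} := fun k => by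
    have h1 := g.enorm_sub_le_of_edist_lt hψ hC hbound (hN N le_rfl (k + N) (by omega))
    rw [mul_one, ← ofReal_norm, ENNReal.ofReal_le_ofReal_iff hC] at h1
    have h2 := norm_add_le (ψ (u N)) (ψ (u (k + N)) - ψ (u N))
    rw [add_sub_cancel] at h2
    exact h2.trans (by gcongr)
  obtain ⟨p, -, φ, hφ, hlim⟩ := tendsto_subseq_of_bounded (hproper _) hmem
  refine ⟨p, ENNReal.tendsto_atTop_zero.2 fun ε hε => ?_⟩
  obtain ⟨M, hM⟩ := hu (ε / 2) (ENNReal.half_pos hε.ne')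
  obtain ⟨D, hD⟩ := g.exists_edist_le p
  have h1 : Tendsto (fun k => ENNReal.ofReal (D * ‖p - u (φ k + N)‖)) atTop (𝓝 0) := by
    have : Tendsto (fun k => D * ‖p - u (φ k + N)‖) atTop (𝓝 (D * ‖p - p‖)) :=
      ((tendsto_const_nhds.sub hlim).norm).const_mul D
    simpa using ENNReal.tendsto_ofReal this
  have h2 := h1.eventually_lt_const (ENNReal.half_pos hε.ne')
  have h3 := hlim.eventually (Metric.closedBall_mem_nhds p one_pos)
  obtain ⟨k, hk2, hk3, hkM⟩ := (h2.and (h3.and (eventually_ge_atTop M))).exists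
  refine ⟨M, fun a ha => ?_⟩
  calc g.edist (u a) p ≤ g.edist (u a) (u (φ k + N)) + g.edist (u (φ k + N)) p :=
        g.edist_triangle _ _ _
    _ ≤ ε / 2 + ε / 2 := by
        gcongr
        · exact (hM a ha _ (by have := hφ.le_apply (x := k); omega)).le
        · exact (hD _ hk3).trans hk2.le
    _ = ε := ENNReal.add_halves ε

end KahlerMetric

/-! ### Behaviour of the momentum coordinate at infinity along a fibre. -/

section Asymptotics

variable {h : ℂ → ℝ} {K : ℝ}

lemma tendsto_moment_atTop (hK : 0 < K) : Tendsto (moment K) atTop atTop := by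
  refine tendsto_atTop.2 fun b => ?_
  filter_upwards [eventually_gt_atTop (|b| * Real.exp (K * |b|)),
    eventually_ge_atTop (0 : ℝ)] with s hs hs0
  by_contra! hlt
  have h1 := moment_mul_exp hK hs0
  have h2 := moment_nonneg hK hs0
  have h3 : moment K s ≤ |b| := hlt.le.trans (le_abs_self b)
  have : moment K s * Real.exp (K * moment K s) ≤ |b| * Real.exp (K * |b|) := by gcongr
  linarith

/-- The reciprocal of the base factor of the metric, in the logarithmic fibre coordinate. -/
def reciprocalFactor (K c x : ℝ) : ℝ := (1 + K * moment K (c * Real.exp (2 * x)))⁻¹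

variable {c : ℝ} (hK : 0 < K) (hc : 0 < c)
include hK hc

lemma tendsto_reciprocalFactor : Tendsto (reciprocalFactor K c) atTop (𝓝 0) := by
  refine tendsto_inv_atTop_zero.comp (tendsto_atTop_add_const_left _ _
    (Tendsto.const_mul_atTop hK ((tendsto_moment_atTop hK).comp
    (Tendsto.const_mul_atTop hc (Real.tendsto_exp_atTop.comp
      (tendsto_id.const_mul_atTop two_pos))))))

/-- From `dτ/dx = 2τ/(1 + Kτ)`, writing `Kτ = 1/y - 1` makes the equation for `y = 1/(1 + Kτ)`
polynomial with a zero at `y = 0`. -/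
lemma hasDerivAt_reciprocalFactor (x : ℝ) : HasDerivAt (reciprocalFactor K c)
    (2 * reciprocalFactor K c x ^ 3 - 2 * reciprocalFactor K c x ^ 2) x := by
  have hs : 0 ≤ c * Real.exp (2 * x) := by positivity
  have hQ := one_add_moment_pos hK hs
  have hE := exp_neg_mul_self hK hs
  have h1 : HasDerivAt (fun x => c * Real.exp (2 * x)) (c * (Real.exp (2 * x) * (2 * 1))) x :=
    (((hasDerivAt_id x).const_mul 2).exp).const_mul c
  have h2 : HasDerivAt (fun x => moment K (c * Real.exp (2 * x))) _ x :=
    (hasDerivAt_moment hK hs).comp x h1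
  refine (((h2.const_mul K).const_add 1).inv hQ.ne').congr_deriv ?_
  simp only [reciprocalFactor]
  field_simp
  linear_combination -K * hE

lemma contDiff_reciprocalFactor : ContDiff ℝ ∞ (reciprocalFactor K c) := by
  refine contDiff_iff_contDiffAt.2 fun x => ?_
  have hs : 0 ≤ c * Real.exp (2 * x) := by positivity
  have h1 : ContDiffAt ℝ ∞ (fun x => moment K (c * Real.exp (2 * x))) x :=
    (contDiffAt_moment hK hs).comp x (f := fun x => c * Real.exp (2 * x)) (by fun_prop)
  exact (contDiffAt_const.add (contDiffAt_const.mul h1)).inv (one_add_moment_pos hK hs).ne'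

/-- Differentiating along the polynomial ODE replaces `P` by `P' · (2X³ - 2X²)`, which vanishes at
`0`. As the factor tends to `0`, so do all its derivatives. -/
lemma exists_iteratedDeriv_reciprocalFactor (b : ℝ) (m : ℕ) : ∃ P : Polynomial ℝ,
    P.eval 0 = 0 ∧ iteratedDeriv m (fun x => b * reciprocalFactor K c x) =
      fun x => P.eval (reciprocalFactor K c x) := by
  induction m with
  | zero => exact ⟨.C b * .X, by simp, by ext x; simp⟩
  | succ m ih =>
    obtain ⟨P, -, hP⟩ := ih
    refine ⟨P.derivative * (2 * .X ^ 3 - 2 * .X ^ 2), by simp, ?_⟩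
    ext x
    rw [iteratedDeriv_succ, hP]
    refine ((P.hasDerivAt _).comp x (hasDerivAt_reciprocalFactor hK hc x)).deriv.trans ?_
    simp

lemma tendsto_iteratedDeriv_reciprocalFactor (b : ℝ) (m : ℕ) :
    Tendsto (iteratedDeriv m fun x => b * reciprocalFactor K c x) atTop (𝓝 0) := by
  obtain ⟨P, hP0, hP⟩ := exists_iteratedDeriv_reciprocalFactor hK hc b m
  rw [hP, ← hP0]
  exact (P.continuous.tendsto 0).comp (tendsto_reciprocalFactor hK hc)

omit hK hc in
lemma tendsto_iteratedFDeriv_comp_re {ψ : ℝ → ℝ} (hψ : ContDiff ℝ ∞ ψ) (m : ℕ)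
    (hlim : Tendsto (iteratedDeriv m ψ) atTop (𝓝 0)) :
    Tendsto (fun ζ : ℂ => ‖iteratedFDeriv ℝ m (fun ξ : ℂ => ψ ξ.re) ζ‖)
      (comap Complex.re atTop) (𝓝 0) := by
  have h1 : Tendsto (fun ζ : ℂ => ‖iteratedDeriv m ψ ζ.re‖) (comap Complex.re atTop) (𝓝 0) :=
    (tendsto_zero_iff_norm_tendsto_zero.1 hlim).comp tendsto_comap
  refine squeeze_zero (fun _ => norm_nonneg _) (fun ζ => ?_) h1
  have h2 := Complex.reCLM.iteratedFDeriv_comp_right hψ ζ (i := m) (by exact_mod_cast le_top)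
  have h3 : (fun ξ : ℂ => ψ ξ.re) = ψ ∘ Complex.reCLM := rfl
  rw [h3, h2]
  refine (ContinuousMultilinearMap.norm_compContinuousLinearMap_le _ _).trans ?_
  simp [norm_iteratedFDeriv_eq_norm_iteratedDeriv]

end Asymptotics

/-! ### Cylindrical ends and completeness of the metric. -/

section MetricProperties

variable {h : ℂ → ℝ} {K : ℝ} (hK : 0 < K) (h_smooth : ContDiff ℝ ∞ h) (h_pos : ∀ z, 0 < h z)
  (h_curv : ∀ z, del 1 (delbar 1 fun x => (Real.log (h x) : ℂ)) z = (K / 2 : ℝ))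

lemma isAsymptoticallyCylindrical_calabiMetric (z : ℂ) : IsAsymptoticallyCylindrical
    ((calabiMetric hK h_smooth h_pos h_curv).fibreFactor z) := by
  -- The cylinder metric has factor `2τ/(1 + Kτ) = 2/K - (2/K)/(1 + Kτ)`.
  refine ⟨2 / K, by positivity, fun m => ?_⟩
  have hfun : (fun ξ : ℂ => (calabiMetric hK h_smooth h_pos h_curv).fibreFactor z (Complex.exp ξ) *
      ‖Complex.exp ξ‖ ^ 2 - 2 / K) =
      fun ξ => -(2 / K) * reciprocalFactor K (h z) ξ.re := by
    ext ξ
    have hn : normSq h ![Complex.exp ξ, z] = h z * Real.exp (2 * ξ.re) := by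
      simp [normSq, Complex.norm_exp, ← Real.exp_nat_mul]
    have hQ := one_add_momentMap_pos hK h_pos ![Complex.exp ξ, z]
    have hE := exp_mul_normSq hK h_pos ![Complex.exp ξ, z]
    rw [KahlerMetric.fibreFactor, show (calabiMetric hK h_smooth h_pos h_curv).coeff _ = _ from
      calabiCoeff_eq hK h_smooth h_pos h_curv _, reciprocalFactor, ← hn, ← momentMap.eq_1]
    have h1 : normSq h ![Complex.exp ξ, z] = h z * ‖Complex.exp ξ‖ ^ 2 := by simp [normSq]
    simp only [blockForm, fibreCoeff, Matrix.of_apply, Matrix.cons_val_zero, Matrix.cons_val_one,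
      Complex.ofReal_re]
    rw [h1] at hE
    field_simp
    linear_combination K * hE
  rw [hfun]
  exact tendsto_iteratedFDeriv_comp_re
    (contDiff_const.mul (contDiff_reciprocalFactor hK (h_pos z))) m
    (tendsto_iteratedDeriv_reciprocalFactor hK (h_pos z) _ m)

lemma norm_apply_one_le_tangentNorm (p v : Fin 2 → ℂ) :
    ‖v 1‖ ≤ (calabiMetric hK h_smooth h_pos h_curv).tangentNorm p v := by
  rw [tangentNorm_calabiMetric]
  refine Real.le_sqrt_of_sq_le ?_
  have h1 := fibreCoeff_pos hK h_pos p
  have h2 := momentMap_nonneg hK h_pos p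
  have h3 : 0 ≤ fibreCoeff K h p * ‖v 0 + p 0 * connCoeff h (p 1) * v 1‖ ^ 2 := by positivity
  have h4 : 0 ≤ K * momentMap K h p * ‖v 1‖ ^ 2 := by positivity
  linarith

/-- The differential of `τ` sees only the fibre part of `v`, and its squared norm there is `2τ/(1 +
Kτ)`, which stays below `2/K`. -/
lemma norm_fderiv_momentMap_le (p v : Fin 2 → ℂ) :
    ‖fderiv ℝ (momentMap K h) p v‖ ≤
      √(2 / K) * (calabiMetric hK h_smooth h_pos h_curv).tangentNorm p v := by
  have hσ := (contDiff_normSq h_smooth).differentiable (by simp) p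
  have hτ := (contDiff_momentMap hK h_smooth h_pos).differentiable (by simp) p
  have hQ := one_add_momentMap_pos hK h_pos p
  have hτ0 := momentMap_nonneg hK h_pos p
  have hE := exp_mul_normSq hK h_pos p
  have hh := h_pos (p 1)
  set X := ‖v 0 + p 0 * connCoeff h (p 1) * v 1‖ with hX
  set e := Real.exp (-(K * momentMap K h p)) with he
  have he0 : 0 < e := Real.exp_pos _
  have h1 : del v (fun x => (momentMap K h x : ℂ)) p =
      (e / (1 + K * momentMap K h p) : ℝ) *
        (h (p 1) * conj (p 0) * (v 0 + p 0 * connCoeff h (p 1) * v 1)) := by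
    refine (del_ofReal_chain hσ (hasDerivAt_moment hK (normSq_nonneg h_pos p))).trans ?_
    rw [del_eq_sum, Fin.sum_univ_two, del_normSq h_smooth h_pos, del_normSq h_smooth h_pos]
    simp only [Matrix.cons_val_zero, Matrix.cons_val_one, ← momentMap.eq_1]
    ring
  have h2 : ‖fderiv ℝ (momentMap K h) p v‖ ≤
      2 * (e / (1 + K * momentMap K h p) * (h (p 1) * ‖p 0‖ * X)) := by
    rw [← Complex.norm_real, ← fderiv_ofReal_comp hτ, fderiv_eq_del_add_delbar, delbar_ofReal hτ]
    refine (norm_add_le _ _).trans ?_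
    rw [Complex.norm_conj, h1]
    simp only [norm_mul, Complex.norm_conj, Complex.norm_real, Real.norm_eq_abs, abs_of_pos hh,
      abs_of_pos (div_pos he0 hQ), ← hX]
    linarith
  refine h2.trans ?_
  rw [tangentNorm_calabiMetric, ← Real.sqrt_mul (by positivity)]
  refine Real.le_sqrt_of_sq_le ?_
  rw [← hX]
  have h3 : 0 ≤ (1 + K * momentMap K h p) * ‖v 1‖ ^ 2 := by positivity
  have h4 : (2 * (e / (1 + K * momentMap K h p) * (h (p 1) * ‖p 0‖ * X))) ^ 2 =
      2 * momentMap K h p / (1 + K * momentMap K h p) * (fibreCoeff K h p * X ^ 2) := by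
    rw [normSq] at hE
    rw [fibreCoeff, ← he]
    field_simp
    linear_combination X ^ 2 * hE
  have h5 : 2 * momentMap K h p / (1 + K * momentMap K h p) ≤ 2 / K := by
    rw [div_le_div_iff₀ hQ hK]
    linarith
  have h6 := fibreCoeff_pos hK h_pos p
  rw [h4]
  gcongr
  linarith

lemma isComplete_calabiMetric : (calabiMetric hK h_smooth h_pos h_curv).IsComplete := by
  have hτ := contDiff_momentMap hK h_smooth h_pos
  have h1 : ContDiff ℝ 1 fun p : Fin 2 → ℂ => p 1 := contDiff_apply ℝ ℂ 1
  have hτ1 : ContDiff ℝ 1 (momentMap K h) := contDiff_infty.1 hτ 1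
  -- The target `ℂ × ℝ` has the sup norm, so the larger of the two Lipschitz bounds serves.
  refine KahlerMetric.isComplete_of_bounded_fderiv _ (h1.prodMk hτ1)
    (C := max 1 √(2 / K)) (by positivity) (fun p v => ?_) fun R => ?_
  · have hp : HasFDerivAt (fun q : Fin 2 → ℂ => q 1)
      (ContinuousLinearMap.proj (R := ℝ) (φ := fun _ => ℂ) 1) p := hasFDerivAt_apply 1 p
    have hd := hp.prodMk (hτ1.differentiable one_ne_zero p).hasFDerivAt
    rw [hd.fderiv]
    have h0 := KahlerMetric.tangentNorm_nonneg (calabiMetric hK h_smooth h_pos h_curv) p v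
    refine max_le ?_ ?_
    · refine (norm_apply_one_le_tangentNorm hK h_smooth h_pos h_curv p v).trans ?_
      exact le_mul_of_one_le_left h0 (le_max_left _ _)
    · refine (norm_fderiv_momentMap_le hK h_smooth h_pos h_curv p v).trans ?_
      exact mul_le_mul_of_nonneg_right (le_max_right _ _) h0
  · rcases lt_or_ge R 0 with hR | hR
    · refine Bornology.isBounded_empty.subset fun p hp => ?_
      exact absurd ((norm_nonneg _).trans hp) (not_le.2 hR)
    -- `h` may decay at infinity, but it is bounded below on the disc `|z| ≤ R`; there a bound on
    -- `τ` bounds `s`, hence `|w|`.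
    obtain ⟨z₀, -, hz₀⟩ := (isCompact_closedBall (0 : ℂ) R).exists_isMinOn
      ⟨0, Metric.mem_closedBall_self hR⟩ h_smooth.continuous.continuousOn
    have hm := h_pos z₀
    set B := R * Real.exp (K * R) / h z₀ with hB
    have hB0 : 0 ≤ B := by positivity
    refine Metric.isBounded_closedBall.subset (t := Metric.closedBall 0 (B + 1 + R)) fun p hp => ?_
    have hp1 : ‖p 1‖ ≤ R := (le_max_left _ _).trans hp
    have hp2 : momentMap K h p ≤ R := (le_abs_self _).trans ((le_max_right _ _).trans hp)
    have hh : h z₀ ≤ h (p 1) := hz₀ (by simpa using hp1)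
    have h2 : normSq h p ≤ R * Real.exp (K * R) := by
      rw [← moment_mul_exp hK (normSq_nonneg h_pos p)]
      have := momentMap_nonneg hK h_pos p
      rw [← momentMap.eq_1]
      gcongr
    have h3 : ‖p 0‖ ^ 2 ≤ B := by
      rw [hB, le_div_iff₀ hm]
      refine le_trans ?_ h2
      rw [normSq, mul_comm]
      gcongr
    have h4 : ‖p 0‖ ≤ B + 1 := by nlinarith [sq_nonneg (‖p 0‖ - 1)]
    rw [mem_closedBall_zero_iff, pi_norm_le_iff_of_nonneg (by positivity)]
    intro i
    fin_cases i
    · exact h4.trans (by simpa using hR)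
    · exact hp1.trans (by simp only [le_add_iff_nonneg_left]; positivity)

end MetricProperties

/-- The coordinates `(w, z)` on the total space of the trivial line bundle over `ℂ`. -/
def trivialBundleCoordinates : Diffeomorph (𝓘(ℂ, ℂ).prod 𝓘(ℂ, ℂ)) 𝓘(ℂ, Fin 2 → ℂ)
    (Bundle.TotalSpace ℂ (Bundle.Trivial ℂ ℂ)) (Fin 2 → ℂ) ω where
  toFun x := ![x.snd, x.proj]
  invFun p := ⟨p 1, p 0⟩
  left_inv x := rfl
  right_inv p := by ext i; fin_cases i <;> rfl
  contMDiff_toFun := by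
    have h1 : ContMDiff (𝓘(ℂ, ℂ).prod 𝓘(ℂ, ℂ)) 𝓘(ℂ, ℂ) ω
        fun x : Bundle.TotalSpace ℂ (Bundle.Trivial ℂ ℂ) => x.proj := Bundle.contMDiff_proj _
    have h2 : ContMDiff (𝓘(ℂ, ℂ).prod 𝓘(ℂ, ℂ)) 𝓘(ℂ, ℂ) ω
        fun x : Bundle.TotalSpace ℂ (Bundle.Trivial ℂ ℂ) => (x.snd : ℂ) := fun x =>
      (Bundle.contMDiffAt_totalSpace.1 (contMDiffAt_id (x := x))).2
    refine contMDiff_pi_space.2 fun i => ?_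
    fin_cases i
    · exact h2
    · exact h1
  contMDiff_invFun := fun p => by
    have h0 : ∀ i : Fin 2, ContMDiffAt 𝓘(ℂ, Fin 2 → ℂ) 𝓘(ℂ, ℂ) ω (fun q : Fin 2 → ℂ => q i) p :=
      fun i => (contDiff_apply ℂ ℂ i).contMDiff p
    exact Bundle.contMDiffAt_totalSpace.2 ⟨h0 1, h0 0⟩

end MomentumKahler
end

theorem mainTheorem8 (k : ℝ) (hk : 0 < k) (h : ℂ → ℝ) (h_smooth : ContDiff ℝ ∞ h)
    (h_pos : ∀ z, 0 < h z)
    (h_curv : ∀ z, MomentumKahler.curvatureCoeff h z = ((-2 * Real.pi * k : ℝ) : ℂ)) :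
    ∃ Φ : Diffeomorph (𝓘(ℂ, ℂ).prod 𝓘(ℂ, ℂ)) 𝓘(ℂ, Fin 2 → ℂ)
        (Bundle.TotalSpace ℂ (Bundle.Trivial ℂ ℂ)) (Fin 2 → ℂ) ω,
      (∀ z w : ℂ, Φ ⟨z, w⟩ = ![w, z]) ∧
      ∃ g : MomentumKahler.KahlerMetric 2,
        g.IsBundleAdapted h ∧
        g.IsComplete ∧
        g.IsScalarFlat ∧
        ¬ g.IsRicciFlat ∧
        ∀ z : ℂ, MomentumKahler.IsAsymptoticallyCylindrical (g.fibreFactor z) := by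
  -- `K = 2πk`: the curvature coefficient is `-2 ∂∂̄ log h`, so the hypothesis says `∂∂̄ log h =
  -- K/2`.
  have hK : 0 < 2 * Real.pi * k := by positivity
  have hc : ∀ z, MomentumKahler.del 1 (MomentumKahler.delbar 1 fun x => (Real.log (h x) : ℂ)) z =
      ((2 * Real.pi * k / 2 : ℝ) : ℂ) := fun z => by
    have h1 := h_curv z
    rw [MomentumKahler.curvatureCoeff] at h1
    push_cast at h1 ⊢
    linear_combination (-1 / 2 : ℂ) * h1
  exact ⟨MomentumKahler.trivialBundleCoordinates, fun z w => rfl,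
    MomentumKahler.calabiMetric hK h_smooth h_pos hc,
    MomentumKahler.isBundleAdapted_calabiMetric hK h_smooth h_pos hc,
    MomentumKahler.isComplete_calabiMetric hK h_smooth h_pos hc,
    MomentumKahler.isScalarFlat_calabiMetric hK h_smooth h_pos hc,
    MomentumKahler.not_isRicciFlat_calabiMetric hK h_smooth h_pos hc,
    MomentumKahler.isAsymptoticallyCylindrical_calabiMetric hK h_smooth h_pos hc⟩
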